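/- Let $n\ge 1$, $d\ge 0$, and let $K\subseteq\mathbb{R}^n$ be a self-dual cone, i.e. $K=K^*=\{y:\langle x,y\rangle\ge 0\ \text{for all }x\in K\}$. A form $f\in\mathbb{R}[x_1,\dots,x_n]$ of degree $d\ge 2$ is called $K$-Lorentzian if for all $a_1,\dots,a_{d-2}\in\operatorname{int}K$ the symmetric matrix $Q$ of the quadratic form $D_{a_1}\cdots D_{a_{d-2}}f$ has exactly one positive eigenvalue (counted with multiplicity) and $y^tQx>0$ for all $x,y\in\operatorname{int}K$; a form of degree $d\le 1$ is $K$-Lorentzian if it is nonnegative on $K$. Let $f$ be a $K$-Lorentzian form of degree $d$, let $a\in K$, and suppose that the Hessian matrix $H=H_f(a)$ is nonsingular. Then $H$ satisfies the generalized Perron–Frobenius property with respect to $K$: if $\rho$ denotes the spectral radius of $H$, then 1. $\rho$ is positive and is a simple eigenvalue of $H$; 2. there is, up to a scalar multiple, exactly one eigenvector $u$ of $H$ with eigenvalue $\rho$ that lies in $\operatorname{int}K$; 3. up to a scalar multiple, $u$ is the only eigenvector of $H$ (for any eigenvalue) that lies in $K\setminus\{0\}$; 4. $K\cap(\rho I-H)\mathbb{R}^n=\{0\}$.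 In particular, $H$ has exactly one positive eigenvalue (counted with multiplicity), this eigenvalue is the spectral radius of $H$, and it has an eigenvector in $\operatorname{int}K$. -/

import Mathlib

open scoped Matrix

namespace ConeLorentzian

/-- The cone `K` is self-dual: it equals its dual `{y | ∀ x ∈ K, 0 ≤ ⟨x, y⟩}` with respect to the
standard inner product of `ℝⁿ`. -/
def IsSelfDual {n : ℕ} (K : ProperCone ℝ (EuclideanSpace ℝ (Fin n))) : Prop :=
  ProperCone.innerDual (K : Set (EuclideanSpace ℝ (Fin n))) = K

/-- The directional derivative `D_v f = ∑ i, v i * ∂f/∂x_i` of a polynomial. -/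
noncomputable def dirDeriv {n : ℕ} (v : EuclideanSpace ℝ (Fin n)) (f : MvPolynomial (Fin n) ℝ) :
    MvPolynomial (Fin n) ℝ :=
  ∑ i, MvPolynomial.C (v i) * MvPolynomial.pderiv i f

/-- The iterated directional derivative `D_{a₁} ⋯ D_{aₘ} f`, for `l = [a₁, …, aₘ]`. -/
noncomputable def iterDirDeriv {n : ℕ} (l : List (EuclideanSpace ℝ (Fin n)))
    (f : MvPolynomial (Fin n) ℝ) : MvPolynomial (Fin n) ℝ :=
  l.foldr dirDeriv f

/-- The Hessian matrix `H_f(a)`. -/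
noncomputable def hessian {n : ℕ} (f : MvPolynomial (Fin n) ℝ) (a : EuclideanSpace ℝ (Fin n)) :
    Matrix (Fin n) (Fin n) ℝ :=
  Matrix.of fun i j => MvPolynomial.eval a.ofLp
    (MvPolynomial.pderiv i (MvPolynomial.pderiv j f))

/-- The symmetric matrix `Q` of a quadratic form `q`, that is `q(x) = xᵀ Q x`; it is half of the
(constant) Hessian of `q`, see `dotProduct_quadMatrix_mulVec`. -/
noncomputable def quadMatrix {n : ℕ} (q : MvPolynomial (Fin n) ℝ) : Matrix (Fin n) (Fin n) ℝ :=
  (1 / 2 : ℝ) • hessian q 0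

/-- The matrix of a quadratic form represents it. -/
theorem dotProduct_quadMatrix_mulVec {n : ℕ} {q : MvPolynomial (Fin n) ℝ} (hq : q.IsHomogeneous 2)
    (x : Fin n → ℝ) : x ⬝ᵥ (quadMatrix q *ᵥ x) = MvPolynomial.eval x q := by
  have key : ∀ i j, MvPolynomial.eval (0 : Fin n → ℝ)
      (MvPolynomial.pderiv i (MvPolynomial.pderiv j q)) =
        MvPolynomial.eval x (MvPolynomial.pderiv i (MvPolynomial.pderiv j q)) := by
    intro i j
    have h0 : (MvPolynomial.pderiv i (MvPolynomial.pderiv j q)).totalDegree = 0 :=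
      Nat.le_zero.1 ((hq.pderiv (i := j)).pderiv (i := i)).totalDegree_le
    rw [MvPolynomial.totalDegree_eq_zero_iff_eq_C.1 h0, MvPolynomial.eval_C, MvPolynomial.eval_C]
  have e2 := congrArg (MvPolynomial.eval x) hq.sum_X_mul_pderiv
  have e1 : ∀ j, ∑ i, x i * MvPolynomial.eval x
      (MvPolynomial.pderiv i (MvPolynomial.pderiv j q)) =
        MvPolynomial.eval x (MvPolynomial.pderiv j q) := by
    intro j
    simpa using congrArg (MvPolynomial.eval x) (hq.pderiv (i := j)).sum_X_mul_pderiv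
  simp only [map_sum, map_mul, MvPolynomial.eval_X, nsmul_eq_mul, Nat.cast_ofNat,
    map_ofNat] at e2
  simp only [dotProduct, Matrix.mulVec, quadMatrix, hessian, Matrix.smul_apply, Matrix.of_apply,
    WithLp.ofLp_zero, smul_eq_mul, key]
  simp only [← e1, Finset.mul_sum] at e2
  have : MvPolynomial.eval x q = (1 / 2) * (2 * MvPolynomial.eval x q) := by ring
  rw [this, ← e2, Finset.sum_comm, Finset.mul_sum]
  refine Finset.sum_congr rfl fun i _ => ?_
  rw [Finset.mul_sum, Finset.mul_sum]
  exact Finset.sum_congr rfl fun j _ => by ring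

/-- A real matrix has exactly one positive eigenvalue, counted with (algebraic) multiplicity. -/
def HasExactlyOnePosEigenvalue {n : ℕ} (A : Matrix (Fin n) (Fin n) ℝ) : Prop :=
  (A.charpoly.roots.filter (fun μ => 0 < μ)).card = 1

/-- `f` is a `K`-Lorentzian form of degree `d`. In degree `d ≥ 2`: for all `a₁, …, a_{d-2}` in the
interior of `K`, the matrix `Q` of the quadratic form `D_{a₁} ⋯ D_{a_{d-2}} f` has exactly one
positive eigenvalue, and `⟨y, Q x⟩ > 0` for all `x, y` in the interior of `K`. In degree `d ≤ 1`:
`f` is nonnegative on `K`. -/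
def IsLorentzian {n : ℕ} (K : ProperCone ℝ (EuclideanSpace ℝ (Fin n))) (d : ℕ)
    (f : MvPolynomial (Fin n) ℝ) : Prop :=
  f.IsHomogeneous d ∧
  (2 ≤ d → ∀ l : List (EuclideanSpace ℝ (Fin n)), l.length = d - 2 →
    (∀ v ∈ l, v ∈ interior (K : Set (EuclideanSpace ℝ (Fin n)))) →
      HasExactlyOnePosEigenvalue (quadMatrix (iterDirDeriv l f)) ∧
      ∀ x ∈ interior (K : Set (EuclideanSpace ℝ (Fin n))),
        ∀ y ∈ interior (K : Set (EuclideanSpace ℝ (Fin n))),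
          0 < inner ℝ y (Matrix.toEuclideanLin (quadMatrix (iterDirDeriv l f)) x)) ∧
  (d ≤ 1 → ∀ x ∈ K, 0 ≤ MvPolynomial.eval x.ofLp f)

/-- `ρ` is the spectral radius of the real matrix `A`: the largest modulus of a complex
eigenvalue. -/
def IsSpectralRadius {n : ℕ} (A : Matrix (Fin n) (Fin n) ℝ) (ρ : ℝ) : Prop :=
  0 ≤ ρ ∧ ENNReal.ofReal ρ = spectralRadius ℂ (A.map (algebraMap ℝ ℂ))

/-- The generalized Perron–Frobenius property of a real matrix `A` with respect to a cone `K`, with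
`ρ` the spectral radius of `A`:
* `ρ` is a positive eigenvalue of `A` that is (algebraically) simple;
* up to a scalar, there is exactly one eigenvector `u` for `ρ` in the interior of `K`;
* up to a scalar, `u` is the only nonzero vector of `K` that is an eigenvector of `A`, for any
  eigenvalue;
* `K ∩ (ρ I - A) ℝⁿ = {0}`. -/
def HasGenPerronFrobenius {n : ℕ} (K : ProperCone ℝ (EuclideanSpace ℝ (Fin n)))
    (A : Matrix (Fin n) (Fin n) ℝ) : Prop :=
  ∃ ρ : ℝ, IsSpectralRadius A ρ ∧
    (0 < ρ ∧ A.charpoly.rootMultiplicity ρ = 1) ∧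
    (∃ u ∈ interior (K : Set (EuclideanSpace ℝ (Fin n))),
      Module.End.HasEigenvector (Matrix.toEuclideanLin A) ρ u ∧
      (∀ v ∈ interior (K : Set (EuclideanSpace ℝ (Fin n))),
        Module.End.HasEigenvector (Matrix.toEuclideanLin A) ρ v → ∃ c : ℝ, 0 < c ∧ v = c • u) ∧
      (∀ v ∈ K, ∀ μ : ℝ,
        Module.End.HasEigenvector (Matrix.toEuclideanLin A) μ v → ∃ c : ℝ, 0 < c ∧ v = c • u)) ∧
    (K : Set (EuclideanSpace ℝ (Fin n))) ∩
      Set.range (fun x => ρ • x - Matrix.toEuclideanLin A x) = {0}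

end ConeLorentzian

namespace ConeLorentzian

variable {n : ℕ}

/-! ### Polynomials -/

/-! Taking every direction equal to an interior point `b` turns the Lorentzian condition into one on
`H_f(b)`: its form is positive on the interior of `K` and has one positive eigenvalue, hence
satisfies a reverse Cauchy–Schwarz inequality. Weak inequalities survive the limit `b → a`
(`IsLorentzian.hessian_mem`). For interior `y ≠ 0`, `H y` is nonzero by nonsingularity and lies in
`K* = K`, so `⟨y, H y⟩ > 0`; Cauchy–Schwarz then makes the form nonpositive on the conjugate of `y`,
which leaves one positive eigenvalue and the others negative (`exists_eigenvalues_pos_forall_neg`).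

Let `u` be the positive eigenvector. The form is negative definite on `u^⊥` but nonnegative on `K`,
so `u^⊥` meets `K` only in `0`, and by convexity `u` or `-u` is interior to `K* = K`
(`IsSelfDual.exists_inner_pos`). Invariance of `K` under `H` bounds the other eigenvalues
(`IsSelfDual.abs_eigenvalues_le`). The remaining claims follow since other eigenvectors and the
range of `ρ I - H` are orthogonal to `u`. -/

theorem pderiv_comm (i j : Fin n) (f : MvPolynomial (Fin n) ℝ) :
    MvPolynomial.pderiv i (MvPolynomial.pderiv j f) =
      MvPolynomial.pderiv j (MvPolynomial.pderiv i f) := by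
  -- The commutator of two derivations is a derivation, so it is enough that it kills the variables.
  have h : ⁅MvPolynomial.pderiv (R := ℝ) i, MvPolynomial.pderiv (R := ℝ) j⁆ = 0 := by
    refine MvPolynomial.derivation_ext fun k => ?_
    rw [Derivation.commutator_apply, MvPolynomial.pderiv_X, MvPolynomial.pderiv_X]
    simp only [Pi.single_apply]
    split_ifs <;> simp
  have h' := congrArg (fun D => D f) h
  simpa [Derivation.commutator_apply, sub_eq_zero] using h'

theorem pderiv_dirDeriv (i : Fin n) (v : EuclideanSpace ℝ (Fin n))
    (f : MvPolynomial (Fin n) ℝ) :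
    MvPolynomial.pderiv i (dirDeriv v f) = dirDeriv v (MvPolynomial.pderiv i f) := by
  simp only [dirDeriv, map_sum, MvPolynomial.pderiv_C_mul]
  exact Finset.sum_congr rfl fun j _ => by rw [pderiv_comm]

theorem pderiv_iterDirDeriv (i : Fin n) (l : List (EuclideanSpace ℝ (Fin n)))
    (f : MvPolynomial (Fin n) ℝ) :
    MvPolynomial.pderiv i (iterDirDeriv l f) = iterDirDeriv l (MvPolynomial.pderiv i f) := by
  induction l with
  | nil => rfl
  | cons v l ih =>
    change MvPolynomial.pderiv i (dirDeriv v (iterDirDeriv l f)) = _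
    rw [pderiv_dirDeriv, ih]
    rfl

theorem isHomogeneous_dirDeriv {m : ℕ} {g : MvPolynomial (Fin n) ℝ}
    (hg : g.IsHomogeneous (m + 1)) (v : EuclideanSpace ℝ (Fin n)) :
    (dirDeriv v g).IsHomogeneous m := by
  refine MvPolynomial.IsHomogeneous.sum _ _ _ fun i _ => ?_
  simpa using (MvPolynomial.isHomogeneous_C (Fin n) (v i)).mul (hg.pderiv (i := i))

theorem eval_dirDeriv_self {m : ℕ} {g : MvPolynomial (Fin n) ℝ} (hg : g.IsHomogeneous m)
    (v : EuclideanSpace ℝ (Fin n)) :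
    MvPolynomial.eval v.ofLp (dirDeriv v g) = m * MvPolynomial.eval v.ofLp g := by
  simpa [dirDeriv] using congrArg (MvPolynomial.eval v.ofLp) hg.sum_X_mul_pderiv

/-- Deriving a form of degree `m` in the same direction `v` for `m` times yields `m!` times its
value at `v`. -/
theorem eval_iterDirDeriv_replicate {m : ℕ} {g : MvPolynomial (Fin n) ℝ}
    (hg : g.IsHomogeneous m) (v : EuclideanSpace ℝ (Fin n)) (x : Fin n → ℝ) :
    MvPolynomial.eval x (iterDirDeriv (List.replicate m v) g) =
      m.factorial * MvPolynomial.eval v.ofLp g := by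
  induction m generalizing g with
  | zero =>
    rw [MvPolynomial.totalDegree_eq_zero_iff_eq_C.1 (Nat.le_zero.1 hg.totalDegree_le)]
    simp [iterDirDeriv]
  | succ m ih =>
    have h := ih (isHomogeneous_dirDeriv hg v)
    rw [eval_dirDeriv_self hg] at h
    -- `foldr` applies the last entry first, so splitting at the end exposes the innermost
    -- derivative.
    rw [List.replicate_succ', iterDirDeriv, List.foldr_append]
    refine h.trans ?_
    rw [Nat.factorial_succ]
    push_cast
    ring

theorem quadMatrix_iterDirDeriv_replicate {m : ℕ} {f : MvPolynomial (Fin n) ℝ}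
    (hf : f.IsHomogeneous (m + 2)) (v : EuclideanSpace ℝ (Fin n)) :
    quadMatrix (iterDirDeriv (List.replicate m v) f) =
      ((m.factorial : ℝ) / 2) • hessian f v := by
  ext i j
  have h : (MvPolynomial.pderiv i (MvPolynomial.pderiv j f)).IsHomogeneous m :=
    (hf.pderiv (i := j)).pderiv (i := i)
  simp only [quadMatrix, hessian, Matrix.smul_apply, Matrix.of_apply, smul_eq_mul,
    pderiv_iterDirDeriv, eval_iterDirDeriv_replicate h]
  ring

theorem hessian_isHermitian (f : MvPolynomial (Fin n) ℝ) (a : EuclideanSpace ℝ (Fin n)) :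
    (hessian f a).IsHermitian := by
  ext i j
  simp only [hessian, Matrix.conjTranspose_apply, Matrix.of_apply, star_trivial]
  rw [pderiv_comm]

theorem hessian_eq_zero {d : ℕ} (hd : d ≤ 1) {f : MvPolynomial (Fin n) ℝ}
    (hf : f.IsHomogeneous d) (a : EuclideanSpace ℝ (Fin n)) : hessian f a = 0 := by
  ext i j
  have h0 : (MvPolynomial.pderiv j f).totalDegree = 0 :=
    Nat.le_zero.1 ((hf.pderiv (i := j)).totalDegree_le.trans (by omega))
  rw [hessian, Matrix.of_apply, MvPolynomial.totalDegree_eq_zero_iff_eq_C.1 h0]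
  simp

theorem continuous_hessian (f : MvPolynomial (Fin n) ℝ) : Continuous (hessian f) := by
  refine continuous_matrix fun i j => ?_
  exact (MvPolynomial.continuous_eval _).comp (PiLp.continuous_ofLp 2 _)

theorem continuous_inner_hessian (f : MvPolynomial (Fin n) ℝ) (x y : EuclideanSpace ℝ (Fin n)) :
    Continuous fun a => inner ℝ x (Matrix.toEuclideanLin (hessian f a) y) := by
  refine continuous_const.inner ?_
  simp only [Matrix.toLpLin_apply]
  exact (PiLp.continuous_toLp 2 _).comp ((continuous_hessian f).matrix_mulVec continuous_const)

/-! ### Self-dual cones -/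

variable {K : ProperCone ℝ (EuclideanSpace ℝ (Fin n))}

theorem IsSelfDual.mem_iff (hK : IsSelfDual K) {y : EuclideanSpace ℝ (Fin n)} :
    y ∈ K ↔ ∀ x ∈ K, 0 ≤ inner ℝ x y := by
  conv_lhs => rw [← hK]
  exact ProperCone.mem_innerDual

/-- A vector orthogonal to `K` lies in `K* = K`, hence is orthogonal to itself; so `K` spans, and a
convex set with full affine span has interior. -/
theorem IsSelfDual.interior_nonempty (hK : IsSelfDual K) :
    (interior (K : Set (EuclideanSpace ℝ (Fin n)))).Nonempty := by
  have hspan : Submodule.span ℝ (K : Set (EuclideanSpace ℝ (Fin n))) = ⊤ := by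
    rw [← Submodule.orthogonal_eq_bot_iff, Submodule.eq_bot_iff]
    intro w hw
    have h0 : ∀ x ∈ K, inner ℝ x w = 0 := fun x hx =>
      (Submodule.mem_orthogonal _ w).1 hw x (Submodule.subset_span hx)
    exact inner_self_eq_zero.1 (h0 w (hK.mem_iff.2 fun x hx => (h0 x hx).ge))
  have hconv : Convex ℝ (K : Set (EuclideanSpace ℝ (Fin n))) := K.convex
  have h0 : (0 : EuclideanSpace ℝ (Fin n)) ∈ (K : Set (EuclideanSpace ℝ (Fin n))) := K.zero_mem
  rw [hconv.interior_nonempty_iff_affineSpan_eq_top,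
    AffineSubspace.affineSpan_eq_top_iff_vectorSpan_eq_top_of_nonempty ℝ _ _ ⟨0, h0⟩,
    vectorSpan_eq_span_vsub_set_right ℝ h0]
  simpa using hspan

theorem exists_pos_add_smul_mem {y : EuclideanSpace ℝ (Fin n)}
    (hy : y ∈ interior (K : Set (EuclideanSpace ℝ (Fin n)))) (w : EuclideanSpace ℝ (Fin n)) :
    ∃ t : ℝ, 0 < t ∧ y + t • w ∈ K := by
  have hc : Filter.Tendsto (fun t : ℝ => y + t • w) (nhdsWithin 0 (Set.Ioi 0)) (nhds y) := by
    have : Continuous fun t : ℝ => y + t • w := by fun_prop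
    simpa using (this.tendsto 0).mono_left nhdsWithin_le_nhds
  obtain ⟨t, h1, h2⟩ := ((hc.eventually (mem_interior_iff_mem_nhds.1 hy)).and
    self_mem_nhdsWithin).exists
  exact ⟨t, h2, h1⟩

theorem IsSelfDual.inner_pos (hK : IsSelfDual K) {y z : EuclideanSpace ℝ (Fin n)}
    (hy : y ∈ interior (K : Set (EuclideanSpace ℝ (Fin n)))) (hz : z ∈ K) (hz0 : z ≠ 0) :
    0 < inner ℝ y z := by
  obtain ⟨t, ht, hm⟩ := exists_pos_add_smul_mem hy (-z)
  have h := hK.mem_iff.1 hz _ hm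
  rw [inner_add_left, inner_smul_left, inner_neg_left] at h
  have h2 : 0 < inner ℝ z z := real_inner_self_pos.2 hz0
  have h3 := mul_pos ht h2
  simp only [conj_trivial] at h
  linarith

/-- By compactness, `⟨u, ·⟩` is at least some `m > 0` on the unit vectors of `K`, so the ball of
radius `m` about `u` lies in `K* = K`. -/
theorem IsSelfDual.mem_interior (hK : IsSelfDual K) {u : EuclideanSpace ℝ (Fin n)}
    (hu : ∀ x ∈ K, x ≠ 0 → 0 < inner ℝ u x) :
    u ∈ interior (K : Set (EuclideanSpace ℝ (Fin n))) := by
  let S := Metric.sphere (0 : EuclideanSpace ℝ (Fin n)) 1 ∩ (K : Set (EuclideanSpace ℝ (Fin n)))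
  have hS : IsCompact S := (isCompact_sphere _ _).inter_right K.isClosed
  have hm : ∃ m : ℝ, 0 < m ∧ ∀ x ∈ S, m ≤ inner ℝ u x := by
    rcases S.eq_empty_or_nonempty with h | h
    · exact ⟨1, one_pos, by simp [h]⟩
    · obtain ⟨x, hx, hmin⟩ := hS.exists_isMinOn h
        (f := fun x => inner ℝ u x) (by fun_prop)
      refine ⟨inner ℝ u x, hu x hx.2 ?_, fun z hz => hmin hz⟩
      rintro rfl
      simpa using hx.1
  obtain ⟨m, hm0, hm⟩ := hm
  refine mem_interior_iff_mem_nhds.2 (Filter.mem_of_superset (Metric.ball_mem_nhds u hm0) ?_)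
  intro v hv
  refine hK.mem_iff.2 fun x hx => ?_
  rcases eq_or_ne x 0 with rfl | hx0
  · simp
  have hn : 0 < ‖x‖ := norm_pos_iff.2 hx0
  have h1 := hm (‖x‖⁻¹ • x) ⟨by simp [norm_smul, hx0], K.smul_mem hx (by positivity)⟩
  rw [inner_smul_right, inv_mul_eq_div, le_div_iff₀ hn] at h1
  have h2 := neg_le_of_abs_le (abs_real_inner_le_norm (v - u) x)
  rw [inner_sub_left] at h2
  have h3 : ‖v - u‖ * ‖x‖ ≤ m * ‖x‖ :=
    mul_le_mul_of_nonneg_right (by simpa [dist_eq_norm] using (Metric.mem_ball.1 hv).le) hn.le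
  rw [real_inner_comm]
  linarith

/-! ### Spectral theory of real symmetric matrices -/

section Spectral

variable {A : Matrix (Fin n) (Fin n) ℝ} (hA : A.IsHermitian)

theorem toEuclideanLin_eigenvectorBasis (j : Fin n) :
    Matrix.toEuclideanLin A (hA.eigenvectorBasis j) =
      hA.eigenvalues j • hA.eigenvectorBasis j := by
  ext k
  simpa using congrFun (hA.mulVec_eigenvectorBasis j) k

theorem inner_eigenvectorBasis_toEuclideanLin (j : Fin n) (x : EuclideanSpace ℝ (Fin n)) :
    inner ℝ (hA.eigenvectorBasis j) (Matrix.toEuclideanLin A x) =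
      hA.eigenvalues j * inner ℝ (hA.eigenvectorBasis j) x := by
  rw [← (Matrix.isSymmetric_toEuclideanLin_iff.2 hA) _ x, toEuclideanLin_eigenvectorBasis,
    inner_smul_left]
  rfl

theorem inner_toEuclideanLin_self (x : EuclideanSpace ℝ (Fin n)) :
    inner ℝ x (Matrix.toEuclideanLin A x) =
      ∑ j, hA.eigenvalues j * inner ℝ (hA.eigenvectorBasis j) x ^ 2 := by
  rw [← hA.eigenvectorBasis.sum_inner_mul_inner x]
  refine Finset.sum_congr rfl fun j _ => ?_
  rw [inner_eigenvectorBasis_toEuclideanLin, real_inner_comm]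
  ring

theorem inner_eigenvectorBasis_mul_eq_zero {μ : ℝ} {v : EuclideanSpace ℝ (Fin n)}
    (hv : Matrix.toEuclideanLin A v = μ • v) (j : Fin n) :
    inner ℝ (hA.eigenvectorBasis j) v = 0 ∨ hA.eigenvalues j = μ := by
  have h := inner_eigenvectorBasis_toEuclideanLin hA j v
  rw [hv, inner_smul_right] at h
  rcases eq_or_ne (inner ℝ (hA.eigenvectorBasis j) v) 0 with h0 | h0
  · exact Or.inl h0
  · exact Or.inr (mul_right_cancel₀ h0 h.symm)

theorem exists_inner_eigenvectorBasis_ne_zero {v : EuclideanSpace ℝ (Fin n)} (hv : v ≠ 0) :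
    ∃ j, inner ℝ (hA.eigenvectorBasis j) v ≠ 0 := by
  by_contra! h
  refine hv ?_
  rw [← hA.eigenvectorBasis.sum_repr v]
  exact Finset.sum_eq_zero fun j _ => by rw [hA.eigenvectorBasis.repr_apply_apply, h, zero_smul]

theorem hasExactlyOnePosEigenvalue_iff :
    HasExactlyOnePosEigenvalue A ↔
      ∃ i, 0 < hA.eigenvalues i ∧ ∀ j, j ≠ i → hA.eigenvalues j ≤ 0 := by
  have h : (A.charpoly.roots.filter (fun μ => 0 < μ)).card =
      (Finset.univ.filter fun i => 0 < hA.eigenvalues i).card := by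
    rw [hA.roots_charpoly_eq_eigenvalues, Multiset.filter_map, Multiset.card_map]
    rfl
  rw [HasExactlyOnePosEigenvalue, h, Finset.card_eq_one]
  refine exists_congr fun i => ?_
  simp only [Finset.ext_iff, Finset.mem_filter, Finset.mem_univ, true_and, Finset.mem_singleton]
  constructor
  · exact fun h => ⟨(h i).2 rfl, fun j hj => not_lt.1 fun h' => hj ((h j).1 h')⟩
  · rintro ⟨h1, h2⟩ j
    exact ⟨fun hj => by_contra fun hne => (h2 j hne).not_gt hj, fun hj => hj ▸ h1⟩

theorem rootMultiplicity_charpoly_eq_one {i : Fin n}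
    (hi : ∀ j, j ≠ i → hA.eigenvalues j ≠ hA.eigenvalues i) :
    A.charpoly.rootMultiplicity (hA.eigenvalues i) = 1 := by
  rw [← Polynomial.count_roots, hA.roots_charpoly_eq_eigenvalues, Multiset.count_map,
    ← Finset.filter_val, Finset.card_val, Finset.card_eq_one]
  refine ⟨i, ?_⟩
  ext j
  simp only [Finset.mem_filter, Finset.mem_univ, true_and, Finset.mem_singleton]
  exact ⟨fun h => by_contra fun hne => hi j hne h.symm, fun h => by rw [h]; rfl⟩

theorem mem_spectrum_map_iff {z : ℂ} :
    z ∈ spectrum ℂ (A.map (algebraMap ℝ ℂ)) ↔ ∃ j, z = hA.eigenvalues j := by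
  rw [Matrix.mem_spectrum_iff_isRoot_charpoly, Matrix.charpoly_map, hA.charpoly_eq,
    Polynomial.map_prod, Polynomial.isRoot_prod]
  simp [sub_eq_zero]

theorem isSpectralRadius_eigenvalues {i : Fin n} (hi : ∀ j, |hA.eigenvalues j| ≤ hA.eigenvalues i) :
    IsSpectralRadius A (hA.eigenvalues i) := by
  have h0 : 0 ≤ hA.eigenvalues i := (abs_nonneg _).trans (hi i)
  refine ⟨h0, le_antisymm ?_ ?_⟩
  · refine le_trans (le_of_eq ?_) (le_iSup₂ (f := fun (k : ℂ) _ => (‖k‖₊ : ENNReal))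
      (hA.eigenvalues i : ℂ) ((mem_spectrum_map_iff hA).2 ⟨i, rfl⟩))
    rw [← ENNReal.ofReal_coe_nnreal, coe_nnnorm, Complex.norm_real, Real.norm_of_nonneg h0]
  · refine iSup₂_le fun z hz => ?_
    obtain ⟨j, rfl⟩ := (mem_spectrum_map_iff hA).1 hz
    rw [← ENNReal.ofReal_coe_nnreal, coe_nnnorm, Complex.norm_real]
    exact ENNReal.ofReal_le_ofReal (hi j)

/-- The reverse Cauchy–Schwarz inequality for a symmetric matrix with one positive eigenvalue. -/
theorem HasExactlyOnePosEigenvalue.mul_le_sq {A : Matrix (Fin n) (Fin n) ℝ}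
    (hA : A.IsHermitian) (h : HasExactlyOnePosEigenvalue A)
    (x : EuclideanSpace ℝ (Fin n)) {y : EuclideanSpace ℝ (Fin n)}
    (hy : 0 < inner ℝ y (Matrix.toEuclideanLin A y)) :
    inner ℝ x (Matrix.toEuclideanLin A x) * inner ℝ y (Matrix.toEuclideanLin A y) ≤
      inner ℝ x (Matrix.toEuclideanLin A y) ^ 2 := by
  obtain ⟨i, -, hi⟩ := (hasExactlyOnePosEigenvalue_iff hA).1 h
  have hneg : ∀ w, inner ℝ (hA.eigenvectorBasis i) w = 0 →
      inner ℝ w (Matrix.toEuclideanLin A w) ≤ 0 := by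
    intro w hw
    rw [inner_toEuclideanLin_self hA]
    refine Finset.sum_nonpos fun j _ => ?_
    rcases eq_or_ne j i with rfl | hj
    · simp [hw]
    · exact mul_nonpos_of_nonpos_of_nonneg (hi j hj) (sq_nonneg _)
  have hsymm : inner ℝ y (Matrix.toEuclideanLin A x) = inner ℝ x (Matrix.toEuclideanLin A y) := by
    rw [← (Matrix.isSymmetric_toEuclideanLin_iff.2 hA) y x, real_inner_comm]
  set p := inner ℝ (hA.eigenvectorBasis i) x with hp
  set q := inner ℝ (hA.eigenvectorBasis i) y with hq
  have hq0 : q ≠ 0 := fun h0 => (hneg y h0).not_gt hy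
  -- The combination is orthogonal to the positive eigenvector. Expanding and multiplying by `C > 0`
  -- gives `q²BC ≤ q²M² - (qM - pC)²`.
  have hw := hneg (q • x - p • y) (by
    rw [inner_sub_right, inner_smul_right, inner_smul_right, ← hp, ← hq]; ring)
  simp only [map_sub, map_smul, inner_sub_left, inner_sub_right, inner_smul_left,
    inner_smul_right, hsymm, conj_trivial] at hw
  set B := inner ℝ x (Matrix.toEuclideanLin A x)
  set C := inner ℝ y (Matrix.toEuclideanLin A y)
  set M := inner ℝ x (Matrix.toEuclideanLin A y)
  have h1 : 0 ≤ (q * M - p * C) ^ 2 := sq_nonneg _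
  have h2 : q ^ 2 * (B * C) ≤ q ^ 2 * M ^ 2 := by
    have := mul_le_mul_of_nonneg_left hw hy.le
    nlinarith
  exact le_of_mul_le_mul_left h2 (by positivity)

/-- A nonsingular symmetric matrix whose form is positive at `y` and negative semidefinite on the
conjugate of `y` has one positive eigenvalue, and all others are negative. -/
theorem exists_eigenvalues_pos_forall_neg (hdet : A.det ≠ 0) {y : EuclideanSpace ℝ (Fin n)}
    (hy : 0 < inner ℝ y (Matrix.toEuclideanLin A y))
    (h : ∀ x, inner ℝ x (Matrix.toEuclideanLin A y) = 0 →
      inner ℝ x (Matrix.toEuclideanLin A x) ≤ 0) :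
    ∃ i, 0 < hA.eigenvalues i ∧ ∀ j, j ≠ i → hA.eigenvalues j < 0 := by
  have hne : ∀ j, hA.eigenvalues j ≠ 0 := by
    rw [hA.det_eq_prod_eigenvalues, Finset.prod_ne_zero_iff] at hdet
    exact fun j => by simpa using hdet j (Finset.mem_univ j)
  obtain ⟨i, hi⟩ : ∃ i, 0 < hA.eigenvalues i := by
    by_contra! hle
    rw [inner_toEuclideanLin_self hA] at hy
    exact hy.not_ge (Finset.sum_nonpos fun j _ =>
      mul_nonpos_of_nonpos_of_nonneg (hle j) (sq_nonneg _))
  refine ⟨i, hi, fun j hj => lt_of_le_of_ne (not_lt.1 fun hpos => ?_) (hne j)⟩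
  have hii : inner ℝ (hA.eigenvectorBasis i) (hA.eigenvectorBasis i) = 1 := by
    simp [hA.eigenvectorBasis.norm_eq_one]
  have hjj : inner ℝ (hA.eigenvectorBasis j) (hA.eigenvectorBasis j) = 1 := by
    simp [hA.eigenvectorBasis.norm_eq_one]
  have hij : inner ℝ (hA.eigenvectorBasis i) (hA.eigenvectorBasis j) = 0 :=
    hA.eigenvectorBasis.inner_eq_zero hj.symm
  have hji : inner ℝ (hA.eigenvectorBasis j) (hA.eigenvectorBasis i) = 0 :=
    hA.eigenvectorBasis.inner_eq_zero hj
  -- The plane of two positive eigenvectors would meet the conjugate of `y` nontrivially: at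
  -- coordinates `(1, 0)` if `p = 0`, at `(-q, p)` otherwise. The form is positive there.
  have key : ∀ α β : ℝ, α * inner ℝ (hA.eigenvectorBasis i) (Matrix.toEuclideanLin A y) +
      β * inner ℝ (hA.eigenvectorBasis j) (Matrix.toEuclideanLin A y) = 0 →
      hA.eigenvalues i * α ^ 2 + hA.eigenvalues j * β ^ 2 ≤ 0 := by
    intro α β hαβ
    have := h (α • hA.eigenvectorBasis i + β • hA.eigenvectorBasis j)
      (by simpa [inner_add_left, inner_smul_left] using hαβ)
    simp only [map_add, map_smul, toEuclideanLin_eigenvectorBasis, inner_add_left,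
      inner_add_right, inner_smul_left, inner_smul_right, hii, hjj, hij, hji,
      conj_trivial] at this
    linarith
  set p := inner ℝ (hA.eigenvectorBasis i) (Matrix.toEuclideanLin A y)
  set q := inner ℝ (hA.eigenvectorBasis j) (Matrix.toEuclideanLin A y)
  rcases eq_or_ne p 0 with h0 | h0
  · have := key 1 0 (by simp [h0])
    simp at this
    linarith
  · have := key (-q) p (by ring)
    have h1 : 0 < hA.eigenvalues j * p ^ 2 := by positivity
    have h2 : 0 ≤ hA.eigenvalues i * (-q) ^ 2 := by positivity
    linarith

end Spectral

/-! ### The Perron–Frobenius property -/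

variable {K : ProperCone ℝ (EuclideanSpace ℝ (Fin n))} {A : Matrix (Fin n) (Fin n) ℝ}

/-- An eigenvector of the only nonnegative eigenvalue has, up to sign, positive inner product with
every nonzero vector of a self-dual cone that the matrix preserves. -/
theorem IsSelfDual.exists_inner_pos (hK : IsSelfDual K) (hA : A.IsHermitian)
    (hAK : ∀ x ∈ K, ∀ y ∈ K, 0 ≤ inner ℝ x (Matrix.toEuclideanLin A y))
    {i : Fin n} (hi : ∀ j, j ≠ i → hA.eigenvalues j < 0) :
    ∃ c : ℝ, c ^ 2 = 1 ∧
      ∀ x ∈ K, x ≠ 0 → 0 < inner ℝ (c • hA.eigenvectorBasis i) x := by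
  have hne : ∀ x ∈ K, x ≠ 0 → inner ℝ (hA.eigenvectorBasis i) x ≠ 0 := by
    intro x hx hx0 h0
    have h := hAK x hx x hx
    obtain ⟨j, hj⟩ := exists_inner_eigenvectorBasis_ne_zero hA hx0
    rw [inner_toEuclideanLin_self hA] at h
    refine h.not_gt (Finset.sum_neg' (fun k _ => ?_) ⟨j, Finset.mem_univ j, ?_⟩)
    · rcases eq_or_ne k i with rfl | hk
      · simp [h0]
      · exact mul_nonpos_of_nonpos_of_nonneg (hi k hk).le (sq_nonneg _)
    · exact mul_neg_of_neg_of_pos (hi j fun hji => hj (hji ▸ h0)) (by positivity)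
  obtain ⟨y, hy⟩ := hK.interior_nonempty
  have hyK : y ∈ K := interior_subset hy
  -- If `0` is interior, `inner_pos` rules out nonzero vectors in `K`.
  rcases eq_or_ne y 0 with rfl | hy0
  · refine ⟨1, by simp, fun x hx hx0 => ?_⟩
    simpa using hK.inner_pos hy hx hx0
  have hsame : ∀ x ∈ K, x ≠ 0 →
      0 < inner ℝ (hA.eigenvectorBasis i) y * inner ℝ (hA.eigenvectorBasis i) x := by
    intro x hx hx0
    by_contra! hle
    have hneg := lt_of_le_of_ne hle (mul_ne_zero (hne y hyK hy0) (hne x hx hx0))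
    set p := inner ℝ (hA.eigenvectorBasis i) y with hp
    set q := inner ℝ (hA.eigenvectorBasis i) x with hq
    -- If `p` and `q` had opposite signs, this nonnegative combination would be a nonzero vector of
    -- `K` orthogonal to the eigenvector.
    have hz : p ^ 2 • x + (-(p * q)) • y ∈ K :=
      K.add_mem (K.smul_mem hx (sq_nonneg p)) (K.smul_mem hyK (by linarith))
    refine hne _ hz (fun h0 => ?_) ?_
    · have h1 := congrArg (fun z => inner ℝ y z) h0
      simp only [inner_add_right, inner_smul_right, inner_zero_right] at h1
      have h2 := hK.inner_pos hy hx hx0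
      have h3 : 0 < inner ℝ y y := real_inner_self_pos.2 hy0
      have h4 : 0 ≤ p ^ 2 * inner ℝ y x := by positivity
      nlinarith
    · rw [inner_add_right, inner_smul_right, inner_smul_right, ← hp, ← hq]
      ring
  rcases lt_or_gt_of_ne (hne y hyK hy0) with h | h
  · refine ⟨-1, by simp, fun x hx hx0 => ?_⟩
    have := neg_of_mul_pos_right (hsame x hx hx0) h.le
    simpa [inner_neg_left] using this
  · refine ⟨1, by simp, fun x hx hx0 => ?_⟩
    simpa using pos_of_mul_pos_right (hsame x hx hx0) h.le

/-- With `u` interior, `x = u + t e_j` is in `K` for some `t > 0`. Then `A^m x` is in `K` too, and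
pairing it with `x` gives `λ_i^m + t² λ_j^m ≥ 0`, which fails for large odd `m` if `-λ_j > λ_i`. -/
theorem IsSelfDual.abs_eigenvalues_le (hK : IsSelfDual K) (hA : A.IsHermitian)
    (hAK : ∀ x ∈ K, ∀ y ∈ K, 0 ≤ inner ℝ x (Matrix.toEuclideanLin A y))
    {i : Fin n} (hpos : 0 < hA.eigenvalues i) (hi : ∀ j, j ≠ i → hA.eigenvalues j < 0)
    {c : ℝ} (hc : c ^ 2 = 1)
    (hu : c • hA.eigenvectorBasis i ∈ interior (K : Set (EuclideanSpace ℝ (Fin n))))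
    (j : Fin n) : |hA.eigenvalues j| ≤ hA.eigenvalues i := by
  rcases eq_or_ne j i with rfl | hj
  · rw [abs_of_pos hpos]
  obtain ⟨t, ht, hx⟩ := exists_pos_add_smul_mem hu (hA.eigenvectorBasis j)
  have hmaps : ∀ z ∈ K, Matrix.toEuclideanLin A z ∈ K := fun z hz =>
    hK.mem_iff.2 fun x hx => hAK x hx z hz
  have hpow : ∀ m : ℕ, hA.eigenvalues i ^ m • c • hA.eigenvectorBasis i +
      hA.eigenvalues j ^ m • t • hA.eigenvectorBasis j ∈ K := by
    intro m
    induction m with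
    | zero => simpa using hx
    | succ m ih =>
      have := hmaps _ ih
      simp only [map_add, map_smul, toEuclideanLin_eigenvectorBasis] at this
      convert this using 2 <;> module
  have hineq : ∀ m : ℕ, 0 ≤ hA.eigenvalues i ^ m + hA.eigenvalues j ^ m * t ^ 2 := by
    intro m
    have h := hK.mem_iff.1 (hpow m) _ hx
    have hij : inner ℝ (hA.eigenvectorBasis i) (hA.eigenvectorBasis j) = 0 :=
      hA.eigenvectorBasis.inner_eq_zero hj.symm
    have hji : inner ℝ (hA.eigenvectorBasis j) (hA.eigenvectorBasis i) = 0 :=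
      hA.eigenvectorBasis.inner_eq_zero hj
    simp only [inner_add_left, inner_add_right, inner_smul_left, inner_smul_right, hij, hji,
      real_inner_self_eq_norm_sq, hA.eigenvectorBasis.norm_eq_one, conj_trivial] at h
    linear_combination h + hA.eigenvalues i ^ m * hc
  rw [abs_of_neg (hi j hj)]
  by_contra! hlt
  have hr : 1 < (-hA.eigenvalues j / hA.eigenvalues i) ^ 2 := by
    have : 1 < -hA.eigenvalues j / hA.eigenvalues i := (one_lt_div hpos).2 hlt
    nlinarith
  -- This `k` gives `λ_i^(2k) < t² λ_j^(2k)`; one more factor makes the exponent odd and the `λ_j`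
  -- term negative.
  obtain ⟨k, hk⟩ := pow_unbounded_of_one_lt (1 / t ^ 2) hr
  rw [div_lt_iff₀ (by positivity), ← pow_mul, div_pow, div_mul_eq_mul_div,
    lt_div_iff₀ (by positivity), one_mul, (even_two_mul k).neg_pow] at hk
  have h1 := hineq (2 * k + 1)
  rw [pow_succ, pow_succ] at h1
  have h2 : 0 < hA.eigenvalues i ^ (2 * k) := by positivity
  nlinarith [mul_lt_mul_of_pos_right hk (neg_pos.2 (hi j hj)), mul_pos h2 (sub_pos.2 hlt)]

/-- A nonsingular symmetric matrix that preserves a self-dual cone and has only one positive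
eigenvalue has the Perron–Frobenius property. -/
theorem IsSelfDual.perronFrobenius (hK : IsSelfDual K) (hA : A.IsHermitian)
    (hAK : ∀ x ∈ K, ∀ y ∈ K, 0 ≤ inner ℝ x (Matrix.toEuclideanLin A y))
    {i : Fin n} (hpos : 0 < hA.eigenvalues i) (hi : ∀ j, j ≠ i → hA.eigenvalues j < 0) :
    HasGenPerronFrobenius K A ∧ HasExactlyOnePosEigenvalue A ∧
    ∀ μ : ℝ, 0 < μ → Module.End.HasEigenvalue (Matrix.toEuclideanLin A) μ →
      IsSpectralRadius A μ ∧
      ∃ u ∈ interior (K : Set (EuclideanSpace ℝ (Fin n))),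
        Module.End.HasEigenvector (Matrix.toEuclideanLin A) μ u := by
  obtain ⟨c, hc, hcpos⟩ := hK.exists_inner_pos hA hAK hi
  have hu := hK.mem_interior hcpos
  have hρ := isSpectralRadius_eigenvalues hA (hK.abs_eigenvalues_le hA hAK hpos hi hc hu)
  have hc0 : c ≠ 0 := by
    rintro rfl
    simp at hc
  have heig : Module.End.HasEigenvector (Matrix.toEuclideanLin A) (hA.eigenvalues i)
      (c • hA.eigenvectorBasis i) := by
    refine ⟨Module.End.mem_eigenspace_iff.2 ?_, smul_ne_zero hc0 ?_⟩
    · rw [map_smul, toEuclideanLin_eigenvectorBasis, smul_comm]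
    · exact hA.eigenvectorBasis.orthonormal.ne_zero i
  have hunique : ∀ v ∈ K, ∀ μ : ℝ, Module.End.HasEigenvector (Matrix.toEuclideanLin A) μ v →
      ∃ r : ℝ, 0 < r ∧ v = r • c • hA.eigenvectorBasis i := by
    intro v hv μ hμ
    have hpv := hcpos v hv hμ.2
    have hAv := Module.End.mem_eigenspace_iff.1 hμ.1
    refine ⟨_, hpv, ?_⟩
    -- Being in `K`, `v` is not orthogonal to `u`, which forces its eigenvalue; its other
    -- coordinates then vanish.
    have hiμ : hA.eigenvalues i = μ :=
      (inner_eigenvectorBasis_mul_eq_zero hA hAv i).resolve_left fun h0 => by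
        simp [inner_smul_left, h0] at hpv
    conv_lhs => rw [← hA.eigenvectorBasis.sum_repr v]
    rw [Finset.sum_eq_single i, hA.eigenvectorBasis.repr_apply_apply, inner_smul_left, smul_smul]
    · congr 1
      simp only [conj_trivial]
      linear_combination -inner ℝ (hA.eigenvectorBasis i) v * hc
    · intro j _ hj
      rw [hA.eigenvectorBasis.repr_apply_apply,
        (inner_eigenvectorBasis_mul_eq_zero hA hAv j).resolve_right
          fun h => ((hi j hj).trans hpos).ne (h.trans hiμ.symm), zero_smul]
    · simp
  refine ⟨⟨_, hρ, ⟨hpos, ?_⟩, ⟨_, hu, heig, ?_, hunique⟩, ?_⟩, ?_, ?_⟩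
  · exact rootMultiplicity_charpoly_eq_one hA fun j hj => ((hi j hj).trans hpos).ne
  · exact fun v hv hv' => hunique v (interior_subset hv) _ hv'
  · refine Set.Subset.antisymm ?_ ?_
    · rintro _ ⟨hz, x, rfl⟩
      by_contra hz0
      refine (hcpos _ hz hz0).ne' ?_
      dsimp only
      rw [inner_smul_left, inner_sub_right, inner_smul_right,
        inner_eigenvectorBasis_toEuclideanLin, sub_self, mul_zero]
    · rintro _ rfl
      exact ⟨K.zero_mem, 0, by simp⟩
  · exact (hasExactlyOnePosEigenvalue_iff hA).2 ⟨i, hpos, fun j hj => (hi j hj).le⟩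
  · intro μ hμ h
    obtain ⟨v, hv⟩ := h.exists_hasEigenvector
    obtain ⟨j, hj⟩ := exists_inner_eigenvectorBasis_ne_zero hA hv.2
    have hjμ := (inner_eigenvectorBasis_mul_eq_zero hA
      (Module.End.mem_eigenspace_iff.1 hv.1) j).resolve_left hj
    have hji : j = i := by_contra fun hne => ((hi j hne).trans hμ).ne hjμ
    rw [← hjμ, hji]
    exact ⟨hρ, _, hu, heig⟩

/-! ### Hessians of Lorentzian forms -/

theorem IsLorentzian.hessian_interior {d : ℕ} {f : MvPolynomial (Fin n) ℝ}
    (hf : IsLorentzian K d f) (hd : 2 ≤ d) {a : EuclideanSpace ℝ (Fin n)}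
    (ha : a ∈ interior (K : Set (EuclideanSpace ℝ (Fin n)))) :
    (∀ x ∈ interior (K : Set (EuclideanSpace ℝ (Fin n))),
      ∀ y ∈ interior (K : Set (EuclideanSpace ℝ (Fin n))),
        0 < inner ℝ x (Matrix.toEuclideanLin (hessian f a) y)) ∧
    ∀ x, ∀ y ∈ interior (K : Set (EuclideanSpace ℝ (Fin n))),
      inner ℝ x (Matrix.toEuclideanLin (hessian f a) x) *
        inner ℝ y (Matrix.toEuclideanLin (hessian f a) y) ≤
          inner ℝ x (Matrix.toEuclideanLin (hessian f a) y) ^ 2 := by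
  obtain ⟨m, rfl⟩ := Nat.exists_eq_add_of_le' hd
  obtain ⟨h1, h2⟩ := hf.2.1 hd (List.replicate m a) (by simp)
    (fun v hv => List.eq_of_mem_replicate hv ▸ ha)
  rw [quadMatrix_iterDirDeriv_replicate hf.1] at h1 h2
  have hc : 0 < (m.factorial : ℝ) / 2 := by positivity
  set c := (m.factorial : ℝ) / 2
  have hherm : (c • hessian f a).IsHermitian := by
    rw [Matrix.IsHermitian, Matrix.conjTranspose_smul, (hessian_isHermitian f a).eq, star_trivial]
  have hB : ∀ x y, inner ℝ x (Matrix.toEuclideanLin (c • hessian f a) y) =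
      c * inner ℝ x (Matrix.toEuclideanLin (hessian f a) y) := fun x y => by
    rw [map_smul, LinearMap.smul_apply, inner_smul_right]
  refine ⟨fun x hx y hy => ?_, fun x y hy => ?_⟩
  · have := h2 y hy x hx
    rw [hB] at this
    exact pos_of_mul_pos_right this hc.le
  · have := HasExactlyOnePosEigenvalue.mul_le_sq hherm h1 x (h2 y hy y hy)
    rw [hB, hB, hB] at this
    have hc2 : 0 < c ^ 2 := by positivity
    refine le_of_mul_le_mul_left ?_ hc2
    linarith

theorem IsSelfDual.closure_interior_eq (hK : IsSelfDual K) :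
    closure (interior (K : Set (EuclideanSpace ℝ (Fin n)))) = K := by
  have hconv : Convex ℝ (K : Set (EuclideanSpace ℝ (Fin n))) := K.convex
  rw [hconv.closure_interior_eq_closure_of_nonempty_interior hK.interior_nonempty,
    K.isClosed.closure_eq]

/-- Having exactly one positive eigenvalue is not a closed condition, but these inequalities are,
and `K` is the closure of its interior. -/
theorem IsLorentzian.hessian_mem {d : ℕ} {f : MvPolynomial (Fin n) ℝ}
    (hK : IsSelfDual K) (hf : IsLorentzian K d f) (hd : 2 ≤ d)
    {a : EuclideanSpace ℝ (Fin n)} (ha : a ∈ K) :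
    (∀ x ∈ K, ∀ y ∈ K, 0 ≤ inner ℝ x (Matrix.toEuclideanLin (hessian f a) y)) ∧
    ∀ x, ∀ y ∈ interior (K : Set (EuclideanSpace ℝ (Fin n))),
      inner ℝ x (Matrix.toEuclideanLin (hessian f a) x) *
        inner ℝ y (Matrix.toEuclideanLin (hessian f a) y) ≤
          inner ℝ x (Matrix.toEuclideanLin (hessian f a) y) ^ 2 := by
  have hB := continuous_inner_hessian f
  have hsub : ∀ S : Set (EuclideanSpace ℝ (Fin n)), IsClosed S →
      interior (K : Set (EuclideanSpace ℝ (Fin n))) ⊆ S → ∀ x ∈ K, x ∈ S := by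
    intro S hS h x hx
    have hx' : x ∈ (K : Set (EuclideanSpace ℝ (Fin n))) := hx
    rw [← hK.closure_interior_eq] at hx'
    exact closure_minimal h hS hx'
  constructor
  · intro x hx y hy
    refine hsub {a | 0 ≤ inner ℝ x (Matrix.toEuclideanLin (hessian f a) y)}
      (isClosed_le continuous_const (hB x y)) (fun b hb => ?_) a ha
    refine hsub {x | 0 ≤ inner ℝ x (Matrix.toEuclideanLin (hessian f b) y)}
      (isClosed_le continuous_const (by fun_prop)) (fun x hx => ?_) x hx
    refine hsub {y | 0 ≤ inner ℝ x (Matrix.toEuclideanLin (hessian f b) y)}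
      (isClosed_le continuous_const
        (continuous_const.inner (LinearMap.continuous_of_finiteDimensional _)))
      (fun y hy => ?_) y hy
    exact ((hf.hessian_interior hd hb).1 x hx y hy).le
  · intro x y hy
    exact hsub {a | inner ℝ x (Matrix.toEuclideanLin (hessian f a) x) *
        inner ℝ y (Matrix.toEuclideanLin (hessian f a) y) ≤
          inner ℝ x (Matrix.toEuclideanLin (hessian f a) y) ^ 2}
      (isClosed_le ((hB x x).mul (hB y y)) ((hB x y).pow 2))
      (fun b hb => (hf.hessian_interior hd hb).2 x y hy) a ha

end ConeLorentzian

theorem mainTheorem4 (n : ℕ) (hn : 0 < n) (d : ℕ)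
    (K : ProperCone ℝ (EuclideanSpace ℝ (Fin n))) (hK : ConeLorentzian.IsSelfDual K)
    (f : MvPolynomial (Fin n) ℝ) (hf : ConeLorentzian.IsLorentzian K d f)
    (a : EuclideanSpace ℝ (Fin n)) (ha : a ∈ K)
    (hdet : (ConeLorentzian.hessian f a).det ≠ 0) :
    ConeLorentzian.HasGenPerronFrobenius K (ConeLorentzian.hessian f a) ∧
    ConeLorentzian.HasExactlyOnePosEigenvalue (ConeLorentzian.hessian f a) ∧
    ∀ μ : ℝ, 0 < μ →
      Module.End.HasEigenvalue (Matrix.toEuclideanLin (ConeLorentzian.hessian f a)) μ →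
      ConeLorentzian.IsSpectralRadius (ConeLorentzian.hessian f a) μ ∧
      ∃ u ∈ interior (K : Set (EuclideanSpace ℝ (Fin n))),
        Module.End.HasEigenvector (Matrix.toEuclideanLin (ConeLorentzian.hessian f a)) μ u := by
  have : Nonempty (Fin n) := ⟨⟨0, hn⟩⟩
  have hd : 2 ≤ d := by
    by_contra! hlt
    refine hdet ?_
    rw [ConeLorentzian.hessian_eq_zero (by omega) hf.1, Matrix.det_zero]
  obtain ⟨hnonneg, hcs⟩ := hf.hessian_mem hK hd ha
  have hA := ConeLorentzian.hessian_isHermitian f a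
  obtain ⟨y, hy⟩ : ∃ y ∈ interior (K : Set (EuclideanSpace ℝ (Fin n))), y ≠ 0 := by
    have : Nontrivial (EuclideanSpace ℝ (Fin n)) := inferInstance
    exact (dense_compl_singleton (0 : EuclideanSpace ℝ (Fin n))).inter_open_nonempty _
      isOpen_interior hK.interior_nonempty
  have hAy : Matrix.toEuclideanLin (ConeLorentzian.hessian f a) y ≠ 0 := by
    intro h0
    refine hdet (Matrix.exists_mulVec_eq_zero_iff.1 ⟨y.ofLp, ?_, ?_⟩)
    · simpa using hy.2
    · simpa [Matrix.toLpLin_apply] using h0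
  -- Self-duality puts `H y` in `K`, so the interior vector `y` pairs strictly positively with it.
  have hpos := hK.inner_pos hy.1 (hK.mem_iff.2 fun x hx =>
    hnonneg x hx y (interior_subset hy.1)) hAy
  obtain ⟨i, hi, hneg⟩ := ConeLorentzian.exists_eigenvalues_pos_forall_neg hA hdet hpos
    fun x hx => by
      have := hcs x y hy.1
      rw [hx, zero_pow two_ne_zero] at this
      exact nonpos_of_mul_nonpos_left this hpos
  exact hK.perronFrobenius hA hnonneg hi hneg
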